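/- **Setting.** There are $A\ge 1$ arms and $D\ge 1$ objectives. In each round $t=1,2,\dots$ the learner selects an arm $a(t)\in\{1,\dots,A\}$ and observes, for every objective $i$, the reward $r^i(t)=\mu^i_{a(t)}+\kappa^i(t)$. Given the past and $a(t)=a$, the noise vector $(\kappa^1(t),\dots,\kappa^D(t))$ has a fixed law $\nu_a$ (with coordinates that may be dependent); every coordinate has mean zero and is $1$-sub-Gaussian, i.e. $\int e^{\lambda x_i}\,d\nu_a(x)\le e^{\lambda^2/2}$ for all $\lambda\in\mathbb R$. A vector $\mu$ lexicographically dominates $\mu'$ in the first $i$ objectives if the two differ in some objective $k\le i$ and $\mu^j>\mu'^j$ for the smallest such $k=j$. Let $\mathcal A_*^i$ be the set of arms $a$ such that no arm's mean vector dominates $(\mu_a^1,\dots,\mu_a^D)$ in the first $i$ objectives (so $\mathcal A_*^0$ is the set of all arms), let $*\in\mathcal A_*^D$ be a lexicographic optimal arm, and put $\mathcal S_*^i=\mathcal A_*^{i-1}\setminus\mathcal A_*^i$, $\Delta_a^i=\mu_*^i-\mu_a^i$ and $\nabla_a^{\max}=\max_{j}|\Delta_a^j|$. The priority-based regret in objective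 $i$ is $\mathrm{Reg}^i_{pb}(T)=\sum_{t=1}^T\Delta^i_{a(t)}\mathbb I\{a(t)\in\mathcal S_*^i\}$. The lexicographic optimal mean rewards are known and normalised: $\mu_*^i=0$ for all $i$. **Algorithm OM-LEX.** Let $N_a(t)$ be the number of selections of arm $a$ before round $t$, and $\hat\mu^i_a(t)$ the sample mean of the rewards of arm $a$ in objective $i$ observed before round $t$. Rounds $1,\dots,A$ select the arms $1,\dots,A$. Afterwards, let $\hat{\mathcal A}_*(t)=\{a:\ |\hat\mu_a^i(t)|<\sqrt{4\log N_a(t)/N_a(t)}\ \text{for all } i\}$. If this set is non-empty, $a(t)$ is drawn from it uniformly at random and the algorithm goes on with round $t+1$; if it is empty, the arms $1,\dots,A$ are selected in the rounds $t,\dots,t+A-1$ and the algorithm goes on with round $t+A$. **Theorem.** When OM-LEX is run, for every objective $i$ and every horizon $T$, $$\mathbb E[\mathrm{Reg}^i_{pb}(T)]\le\sum_{a\in\mathcal S_*^i}\left(\left(\frac{\pi^2}{3}D+1\right)\Delta_a^i+\frac{36}{\nabla_a^{\max}}\log^+\frac{17}{\nabla_a^{\max}}\right),\qquad \log^+x=\max(\log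 x,0).$$ If moreover every $a\in\mathcal S_*^i$ satisfies $\nabla_a^{\max}\le 17$ or $\nabla_a^{\max}=\Delta_a^i$ (the latter always holds when $D=1$), then for every horizon $T$ $$\mathbb E[\mathrm{Reg}^i_{pb}(T)]\le\sum_{a\in\mathcal S_*^i}\left(\left(\frac{\pi^2}{3}D+1\right)\Delta_a^i+\frac{36}{\nabla_a^{\max}}\log\frac{17}{\nabla_a^{\max}}\right).$$ Both bounds do not depend on $T$. -/

import Mathlib

open MeasureTheory ProbabilityTheory

noncomputable section

/-- A stochastic bandit with `A` arms and `D` objectives: the expected rewards `mean a i`, and for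
each arm a law `noise a` of the noise vector on `ℝ^D`, whose coordinates (possibly dependent) are
centred and `1`-sub-Gaussian, that is `E[exp (l X)] ≤ exp (l ^ 2 / 2)` for all real `l`. -/
structure LexBandit (A D : ℕ) where
  mean : Fin A → Fin D → ℝ
  noise : Fin A → Measure (Fin D → ℝ)
  noise_prob : ∀ a, IsProbabilityMeasure (noise a)
  noise_centred : ∀ a i, ∫ x, x i ∂(noise a) = 0
  noise_subgaussian : ∀ a i, HasSubgaussianMGF (fun x : Fin D → ℝ => x i) 1 (noise a)

namespace LexBandit

variable {A D : ℕ}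

/-- `x` lexicographically dominates `y` in the first `k` objectives: they differ in one of these
objectives and `x` is larger in the first one in which they differ. Objectives are numbered from
`0`, so that the first `k` objectives are those with index less than `k`. -/
def LexDominates (k : ℕ) (x y : Fin D → ℝ) : Prop :=
  ∃ j : Fin D, j.val < k ∧ (∀ l : Fin D, l < j → x l = y l) ∧ y j < x j

open Classical in
/-- The arms that are lexicographic optimal in the first `k` objectives (all arms if `k = 0`). -/
def optArms (B : LexBandit A D) (k : ℕ) : Finset (Fin A) :=
  Finset.univ.filter fun a => ∀ a', ¬ LexDominates k (B.mean a') (B.mean a)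

/-- The arms that are lexicographic optimal in all objectives before `i`, but not in the objectives
up to and including `i`. For the first objective, `optArms 0` is the set of all arms. -/
def subArms (B : LexBandit A D) (i : Fin D) : Finset (Fin A) :=
  B.optArms i.val \ B.optArms (i.val + 1)

/-- The gap of arm `a` in objective `i`, relative to a lexicographic optimal arm `star`. -/
def gap (B : LexBandit A D) (star a : Fin A) (i : Fin D) : ℝ :=
  B.mean star i - B.mean a i

/-- The largest absolute gap of arm `a` over all objectives. -/
def maxAbsGap (B : LexBandit A D) (star a : Fin A) : ℝ :=
  ⨆ j : Fin D, |B.gap star a j|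

/-- The priority-based regret in objective `i` after `T` rounds, for the arms `arm 0, arm 1, …`
(rounds are numbered from `0`). -/
def regretPB (B : LexBandit A D) (star : Fin A) (i : Fin D) (arm : ℕ → Fin A) (T : ℕ) : ℝ :=
  ∑ t ∈ Finset.range T, if arm t ∈ B.subArms i then B.gap star (arm t) i else 0

/-- The noise law, as a kernel from the past and the currently selected arm: it depends on the
arm only. -/
def noiseKernel (B : LexBandit A D) (H : Type*) [MeasurableSpace H] :
    Kernel (H × Fin A) (Fin D → ℝ) :=
  (Kernel.ofFunOfCountable B.noise).comap Prod.snd measurable_snd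

end LexBandit

namespace OMLEX

variable {A D : ℕ}

/-- The number of rounds before round `t` in which arm `a` was selected. -/
def count (arm : ℕ → Fin A) (a : Fin A) (t : ℕ) : ℕ :=
  ((Finset.range t).filter fun s => arm s = a).card

/-- The sample mean, at the beginning of round `t`, of the rewards of arm `a` in objective `i`. -/
def sampleMean (arm : ℕ → Fin A) (rwd : ℕ → Fin D → ℝ) (a : Fin A) (i : Fin D) (t : ℕ) : ℝ :=
  (∑ s ∈ (Finset.range t).filter (fun s => arm s = a), rwd s i) / (count arm a t : ℝ)

open Classical in
/-- The set of estimated lexicographic optimal arms at the beginning of round `t`, when the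
lexicographic optimal expected rewards are known to be `0`. -/
def estOpt (arm : ℕ → Fin A) (rwd : ℕ → Fin D → ℝ) (t : ℕ) : Finset (Fin A) :=
  Finset.univ.filter fun a => ∀ i : Fin D,
    |sampleMean arm rwd a i t| < √(4 * Real.log (count arm a t) / (count arm a t))

/-- The position inside a round-robin exploration block at the beginning of round `t`: it is `0` if
no block is in progress, and otherwise the (nonzero) index of the next arm of the block. A block
begins in a round `t ≥ A` in which no block is in progress and `estOpt` is empty. -/
def blockPos (arm : ℕ → Fin A) (rwd : ℕ → Fin D → ℝ) : ℕ → ℕ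
  | 0 => 0
  | t + 1 =>
    if t < A then 0
    else if blockPos arm rwd t ≠ 0 ∨ estOpt arm rwd t = ∅ then (blockPos arm rwd t + 1) % A
    else 0

/-- The probability with which the algorithm selects arm `a` in round `t`, as a function of what
was selected and observed before round `t`: in the first `A` rounds each arm is selected once, in
order; then a block in progress is continued; if there is none, an arm of `estOpt` is selected
uniformly at random, or, if that set is empty, a block is started with the first arm. -/
def selectProb (arm : ℕ → Fin A) (rwd : ℕ → Fin D → ℝ) (t : ℕ) (a : Fin A) : ℝ :=
  if t < A then (if a.val = t then 1 else 0)
  else if blockPos arm rwd t ≠ 0 ∨ estOpt arm rwd t = ∅ then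
    (if a.val = blockPos arm rwd t then 1 else 0)
  else if a ∈ estOpt arm rwd t then ((estOpt arm rwd t).card : ℝ)⁻¹ else 0

variable {Ω : Type*}

/-- The arms selected and the reward vectors observed before round `t`. -/
def history (arm : ℕ → Ω → Fin A) (rwd : ℕ → Ω → Fin D → ℝ) (t : ℕ) (ω : Ω) :
    Fin t → Fin A × (Fin D → ℝ) :=
  fun s => (arm s ω, rwd s ω)

/-- The random arms `arm t` and reward vectors `rwd t` arise when the algorithm is run on the
bandit `B`: given the past, the arm is drawn according to `selectProb`, and given the past and the
selected arm, the noise (the reward minus the expected reward of the arm) has the noise law of that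
arm. -/
structure IsRun [MeasurableSpace Ω] (B : LexBandit A D) (P : Measure Ω)
    (arm : ℕ → Ω → Fin A) (rwd : ℕ → Ω → Fin D → ℝ) : Prop where
  measurable_arm : ∀ t, Measurable (arm t)
  measurable_rwd : ∀ t, Measurable (rwd t)
  arm_law : ∀ t a,
    P[Set.indicator {ω | arm t ω = a} (fun _ => (1 : ℝ)) |
        MeasurableSpace.comap (history arm rwd t) inferInstance]
      =ᵐ[P] fun ω => selectProb (fun s => arm s ω) (fun s => rwd s ω) t a
  noise_law : ∀ t,
    HasCondDistrib (fun ω i => rwd t ω i - B.mean (arm t ω) i)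
      (fun ω => (history arm rwd t ω, arm t ω))
      (B.noiseKernel (Fin t → Fin A × (Fin D → ℝ))) P

end OMLEX

end

/-! The regret is the sum over suboptimal arms `a` of the gap times the expected number of
selections of `a`, so everything rests on `IsRun.integral_count_le`: with `x` the largest absolute
gap, this number is at most `π²D/3 + 1 + 36/x² · log (17/x)`.

Random rounds are replaced by deterministic counts (`count_le_add`). Besides its initial selection,
`a` is selected in a block, whose start is labelled by the number `n` of selections of the optimal
arm, or as an estimated optimal arm, labelled by its own number of selections. Labels do not repeat
within either kind, so the expected count is at most 1 plus a sum over `n` of probabilities, without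
a union bound over rounds.

Each probability concerns only the first `n` rewards of one arm. An exponential supermartingale
bounds a one-sided error of size `radius n` by `n⁻²`. An empty estimate forces an error at the
optimal arm, on one of two sides in one of `D` objectives: `2D n⁻²`. Accepting `a` forces an error
once `2 * radius n ≤ x`; the remaining `n` are counted deterministically and give the logarithm.

Since the gap in objective `i` is at most `x`, multiplying by it turns `36/x²` into `36/x` if the
logarithm is nonnegative. For a negative logarithm the inequality reverses unless the gap equals
`x`; hence the two forms of the bound. -/

noncomputable section

namespace OMLEX

variable {A D : ℕ}

/-! ### Pathwise counting of selections and blocks. -/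

lemma count_succ (arm : ℕ → Fin A) (a : Fin A) (t : ℕ) :
    count arm a (t + 1) = count arm a t + if arm t = a then 1 else 0 := by
  unfold count
  rw [Finset.range_add_one, Finset.filter_insert]
  split_ifs with h
  · rw [Finset.card_insert_of_notMem (by simp)]
  · simp

lemma count_mono (arm : ℕ → Fin A) (a : Fin A) : Monotone (count arm a) :=
  monotone_nat_of_le_succ fun t => by rw [count_succ]; omega

lemma count_lt_count {arm : ℕ → Fin A} {a : Fin A} {r s t : ℕ} (hr : arm r = a)
    (hsr : s ≤ r) (hrt : r < t) : count arm a s < count arm a t := by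
  have h1 := count_mono arm a hsr
  have h2 := count_mono arm a (show r + 1 ≤ t from hrt)
  rw [count_succ, if_pos hr] at h2
  omega

lemma count_le (arm : ℕ → Fin A) (a : Fin A) (t : ℕ) : count arm a t ≤ t := by
  simpa [count] using Finset.card_filter_le (Finset.range t) (fun s => arm s = a)

lemma blockPos_lt (arm : ℕ → Fin A) (rwd : ℕ → Fin D → ℝ) (hA : 0 < A) (t : ℕ) :
    blockPos arm rwd t < A := by
  cases t with
  | zero => simpa [blockPos]
  | succ t =>
    rw [blockPos]
    split_ifs
    · exact hA
    · exact Nat.mod_lt _ hA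
    · exact hA

/-- A block in progress at position `k` was started `k` rounds earlier. -/
lemma exists_block_start {arm : ℕ → Fin A} {rwd : ℕ → Fin D → ℝ} (hA : 0 < A) (t : ℕ) :
    blockPos arm rwd t ≠ 0 →
      ∃ s, A ≤ s ∧ s + blockPos arm rwd t = t ∧ blockPos arm rwd s = 0 ∧
        estOpt arm rwd s = ∅ := by
  induction t with
  | zero => simp [blockPos]
  | succ t ih =>
    intro h
    rw [blockPos] at h ⊢
    by_cases htA : t < A
    · simp [htA] at h
    by_cases hb : blockPos arm rwd t ≠ 0 ∨ estOpt arm rwd t = ∅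
    swap
    · simp [htA, hb] at h
    rw [if_neg htA, if_pos hb] at h ⊢
    have hlt := blockPos_lt arm rwd hA t
    have hmod : (blockPos arm rwd t + 1) % A = blockPos arm rwd t + 1 := by
      rcases Nat.lt_or_ge (blockPos arm rwd t + 1) A with h' | h'
      · exact Nat.mod_eq_of_lt h'
      · have : blockPos arm rwd t + 1 = A := by omega
        rw [this, Nat.mod_self] at h
        exact absurd rfl h
    rw [hmod]
    by_cases h0 : blockPos arm rwd t = 0
    · exact ⟨t, by omega, by omega, h0, hb.resolve_left (by simpa using h0)⟩
    · obtain ⟨s, hs1, hs2, hs3, hs4⟩ := ih h0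
      exact ⟨s, hs1, by omega, hs3, hs4⟩

lemma blockPos_add {arm : ℕ → Fin A} {rwd : ℕ → Fin D → ℝ} {s : ℕ} (hs : A ≤ s)
    (h0 : blockPos arm rwd s = 0) (he : estOpt arm rwd s = ∅) (k : ℕ) (hk : k < A) :
    blockPos arm rwd (s + k) = k := by
  induction k with
  | zero => simpa using h0
  | succ k ih =>
    have ih := ih (by omega)
    rw [← add_assoc, blockPos, if_neg (by omega), if_pos, ih, Nat.mod_eq_of_lt hk]
    by_cases hk0 : k = 0
    · subst hk0; exact Or.inr he
    · exact Or.inl (by omega)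

section Consistent

variable {arm : ℕ → Fin A} {rwd : ℕ → Fin D → ℝ}
  (hsel : ∀ t, selectProb arm rwd t (arm t) ≠ 0)

include hsel

lemma arm_val_of_lt {t : ℕ} (ht : t < A) : (arm t).val = t := by
  have h := hsel t
  by_contra hne
  simp [selectProb, ht, hne] at h

lemma arm_val_of_block {t : ℕ} (ht : A ≤ t)
    (hb : blockPos arm rwd t ≠ 0 ∨ estOpt arm rwd t = ∅) :
    (arm t).val = blockPos arm rwd t := by
  have h := hsel t
  rw [selectProb, if_neg (by omega), if_pos hb] at h
  by_contra hne
  exact h (if_neg hne)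

lemma arm_mem_estOpt {t : ℕ} (ht : A ≤ t)
    (hb : ¬ (blockPos arm rwd t ≠ 0 ∨ estOpt arm rwd t = ∅)) :
    arm t ∈ estOpt arm rwd t := by
  have h := hsel t
  rw [selectProb, if_neg (by omega), if_neg hb] at h
  by_contra hne
  exact h (if_neg hne)

lemma count_pos_of_le (a : Fin A) {t : ℕ} (ht : A ≤ t) : 0 < count arm a t := by
  have h : arm a.val = a := Fin.ext (arm_val_of_lt hsel a.isLt)
  have := count_lt_count h (Nat.zero_le _) (lt_of_lt_of_le a.isLt ht)
  omega

/-- Different blocks start at rounds with different numbers of selections of any given arm. -/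
lemma count_lt_of_block_starts (b : Fin A) {s s' : ℕ} (hs : A ≤ s)
    (h0 : blockPos arm rwd s = 0) (he : estOpt arm rwd s = ∅)
    (h0' : blockPos arm rwd s' = 0) (hlt : s < s') : count arm b s < count arm b s' := by
  -- Inside the block begun at `s` the position is nonzero, so no other block can start before it
  -- ends; the complete block selects `b` once.
  have hgap : s + A ≤ s' := by
    by_contra hcon
    have h := blockPos_add hs h0 he (s' - s) (by omega)
    rw [show s + (s' - s) = s' by omega, h0'] at h
    omega
  have hk := blockPos_add hs h0 he b.val b.isLt
  have harm : arm (s + b.val) = b := by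
    apply Fin.ext
    rw [arm_val_of_block hsel (by omega), hk]
    by_cases hb : b.val = 0
    · right; simpa [hb] using he
    · left; omega
  have := b.isLt
  exact count_lt_count harm (by omega) (by omega)

open Classical in
/-- Apart from its initial selection, an arm is selected as an estimated optimal arm or in a
block; the selections of the first kind are numbered by the count of the arm itself, the blocks by
the count of an arbitrary reference arm `b`. -/
lemma count_le_add (a b : Fin A) (T : ℕ) :
    count arm a T ≤ 1 +
      ((Finset.Icc 1 T).filter fun n =>
        ∃ s < T, count arm b s = n ∧ estOpt arm rwd s = ∅).card +
      ((Finset.Icc 1 T).filter fun n =>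
        ∃ t < T, count arm a t = n ∧ a ∈ estOpt arm rwd t).card := by
  have hA : 0 < A := a.pos
  let I := (Finset.range T).filter fun t => arm t = a ∧ t < A
  let J := (Finset.range T).filter fun t => arm t = a ∧ A ≤ t ∧
    (blockPos arm rwd t ≠ 0 ∨ estOpt arm rwd t = ∅)
  let K := (Finset.range T).filter fun t => arm t = a ∧ A ≤ t ∧ a ∈ estOpt arm rwd t
  have hsub : (Finset.range T).filter (fun t => arm t = a) ⊆ I ∪ J ∪ K := by
    intro t ht
    simp only [Finset.mem_filter, Finset.mem_union, I, J, K] at ht ⊢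
    by_cases h1 : t < A
    · exact Or.inl (Or.inl ⟨ht.1, ht.2, h1⟩)
    by_cases h2 : blockPos arm rwd t ≠ 0 ∨ estOpt arm rwd t = ∅
    · exact Or.inl (Or.inr ⟨ht.1, ht.2, by omega, h2⟩)
    · have := arm_mem_estOpt hsel (by omega) h2
      rw [ht.2] at this
      exact Or.inr ⟨ht.1, ht.2, by omega, this⟩
  have hI : I.card ≤ 1 := by
    rw [Finset.card_le_one]
    intro s hs t ht
    simp only [Finset.mem_filter, I] at hs ht
    rw [← arm_val_of_lt hsel hs.2.2, ← arm_val_of_lt hsel ht.2.2, hs.2.1, ht.2.1]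
  have hstart : ∀ t ∈ J, ∃ s, A ≤ s ∧ s + a.val = t ∧ blockPos arm rwd s = 0 ∧
      estOpt arm rwd s = ∅ := by
    intro t ht
    simp only [Finset.mem_filter, J] at ht
    obtain ⟨-, hat, htA, hb⟩ := ht
    have hv := arm_val_of_block hsel htA hb
    rw [hat] at hv
    by_cases h0 : blockPos arm rwd t = 0
    · exact ⟨t, htA, by omega, h0, hb.resolve_left (by simpa using h0)⟩
    · rw [hv]; exact exists_block_start hA t h0
  have hJ : J.card ≤ ((Finset.Icc 1 T).filter fun n =>
      ∃ s < T, count arm b s = n ∧ estOpt arm rwd s = ∅).card := by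
    -- Arm `a` sits at position `a.val` of a block, so `t - a.val` is the round in which the block
    -- started.
    refine Finset.card_le_card_of_injOn (fun t => count arm b (t - a.val)) ?_ ?_
    · intro t ht
      obtain ⟨s, hs, hst, h0, he⟩ := hstart t ht
      have htT : t < T := by
        have := (Finset.mem_filter.1 (Finset.mem_coe.1 ht)).1
        simpa using this
      have hst' : t - a.val = s := by omega
      have hpos := count_pos_of_le hsel b hs
      have hle := count_le arm b s
      simp only [Finset.coe_filter, Finset.mem_Icc, Set.mem_ofPred_eq, hst']
      exact ⟨⟨hpos, by omega⟩, s, by omega, rfl, he⟩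
    · intro t ht t' ht' heq
      obtain ⟨s, hs, hst, h0, he⟩ := hstart t ht
      obtain ⟨s', hs', hst', h0', he'⟩ := hstart t' ht'
      have e : t - a.val = s := by omega
      have e' : t' - a.val = s' := by omega
      simp only [e, e'] at heq
      rcases lt_trichotomy s s' with h | h | h
      · have := count_lt_of_block_starts hsel b hs h0 he h0' h
        omega
      · omega
      · have := count_lt_of_block_starts hsel b hs' h0' he' h0 h
        omega
  have hK : K.card ≤ ((Finset.Icc 1 T).filter fun n =>
      ∃ t < T, count arm a t = n ∧ a ∈ estOpt arm rwd t).card := by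
    refine Finset.card_le_card_of_injOn (fun t => count arm a t) ?_ ?_
    · intro t ht
      simp only [Finset.coe_filter, Finset.mem_range, Set.mem_ofPred_eq, K,
        Finset.mem_Icc] at ht ⊢
      have hpos := count_pos_of_le hsel a ht.2.2.1
      have hle := count_le arm a t
      exact ⟨⟨hpos, by omega⟩, t, ht.1, rfl, ht.2.2.2⟩
    · intro t ht t' ht' heq
      simp only [Finset.coe_filter, Set.mem_ofPred_eq, K] at ht ht' heq
      rcases lt_trichotomy t t' with h | h | h
      · have := count_lt_count ht.2.1 le_rfl h
        omega
      · exact h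
      · have := count_lt_count ht'.2.1 le_rfl h
        omega
  have h1 := Finset.card_le_card hsub
  have h2 := Finset.card_union_le (I ∪ J) K
  have h3 := Finset.card_union_le I J
  change count arm a T ≤ _ at h1
  omega

end Consistent

/-! ### Exponential supermartingale and deviation inequality. -/

open scoped ENNReal

/-- The sum of the first `n` noise terms of arm `a` in objective `j`, as far as they are observed
before round `t`, weighted by `l` and compensated by `l ^ 2 / 2` per term. -/
def compensatedSum (B : LexBandit A D) (arm : ℕ → Fin A) (rwd : ℕ → Fin D → ℝ) (a : Fin A)
    (j : Fin D) (n : ℕ) (l : ℝ) (t : ℕ) : ℝ :=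
  ∑ s ∈ Finset.range t, if arm s = a ∧ count arm a s < n then
    l * (rwd s j - B.mean (arm s) j) - l ^ 2 / 2 else 0

/-- The sum of the noise terms of arm `a` in objective `j` observed before round `t`. -/
def noiseSum (B : LexBandit A D) (arm : ℕ → Fin A) (rwd : ℕ → Fin D → ℝ) (a : Fin A)
    (j : Fin D) (t : ℕ) : ℝ :=
  ∑ s ∈ (Finset.range t).filter (fun s => arm s = a), (rwd s j - B.mean (arm s) j)

/-- The sum freezes after `n` selections, so the state at any round with count `n` can be read off
at the fixed time `T`. This lets Markov's inequality at `T` cover all such rounds at once. -/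
lemma compensatedSum_eq (B : LexBandit A D) (arm : ℕ → Fin A) (rwd : ℕ → Fin D → ℝ) (a : Fin A)
    (j : Fin D) (l : ℝ) {t T : ℕ} (htT : t ≤ T) :
    compensatedSum B arm rwd a j (count arm a t) l T =
      l * noiseSum B arm rwd a j t - count arm a t * (l ^ 2 / 2) := by
  have h : (Finset.range T).filter (fun s => arm s = a ∧ count arm a s < count arm a t) =
      (Finset.range t).filter (fun s => arm s = a) := by
    ext s
    simp only [Finset.mem_filter, Finset.mem_range]
    constructor
    · rintro ⟨-, h1, h2⟩
      refine ⟨?_, h1⟩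
      by_contra hcon
      have := count_mono arm a (show t ≤ s by omega)
      omega
    · rintro ⟨h1, h2⟩
      exact ⟨by omega, h2, count_lt_count h2 le_rfl h1⟩
  rw [compensatedSum, ← Finset.sum_filter, h, Finset.sum_sub_distrib, noiseSum, Finset.mul_sum]
  simp [count]

lemma noiseSum_eq (B : LexBandit A D) (arm : ℕ → Fin A) (rwd : ℕ → Fin D → ℝ) (a : Fin A)
    (j : Fin D) {t : ℕ} (ht : count arm a t ≠ 0) :
    noiseSum B arm rwd a j t = count arm a t * (sampleMean arm rwd a j t - B.mean a j) := by
  have ht' : (count arm a t : ℝ) ≠ 0 := by exact_mod_cast ht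
  have h : ∑ s ∈ (Finset.range t).filter (fun s => arm s = a), B.mean (arm s) j =
      count arm a t * B.mean a j := by
    rw [Finset.sum_congr rfl (g := fun _ => B.mean a j)]
    · simp [count]
    · intro s hs
      rw [(Finset.mem_filter.1 hs).2]
  rw [noiseSum, Finset.sum_sub_distrib, h, sampleMean]
  field_simp

variable {Ω : Type*} {B : LexBandit A D} {arm : ℕ → Ω → Fin A} {rwd : ℕ → Ω → Fin D → ℝ}

lemma measurable_count {m : MeasurableSpace Ω} {t : ℕ}
    (h : ∀ s < t, Measurable[m] (arm s)) (a : Fin A) :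
    Measurable[m] fun ω => count (fun s => arm s ω) a t := by
  induction t with
  | zero => simp [count]
  | succ t ih =>
    simp only [count_succ]
    refine (ih fun s hs => h s (by omega)).add ?_
    exact Measurable.ite (h t (by omega) (measurableSet_singleton a)) measurable_const
      measurable_const

lemma measurable_compensatedSum {m : MeasurableSpace Ω} {t : ℕ}
    (h : ∀ s < t, Measurable[m] (arm s)) (h' : ∀ s < t, Measurable[m] (rwd s)) (a : Fin A)
    (j : Fin D) (n : ℕ) (l : ℝ) :
    Measurable[m] fun ω =>
      compensatedSum B (fun s => arm s ω) (fun s => rwd s ω) a j n l t := by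
  refine Finset.measurable_sum _ fun s hs => ?_
  have hs := Finset.mem_range.1 hs
  refine Measurable.ite ?_ ?_ measurable_const
  · exact (h s hs (measurableSet_singleton a)).inter
      (measurableSet_lt (measurable_count (fun r hr => h r (by omega)) a) measurable_const)
  · refine Measurable.sub_const (Measurable.const_mul (Measurable.sub ?_ ?_) l) _
    · exact (measurable_pi_apply j).comp (h' s hs)
    · exact (measurable_of_countable fun b => B.mean b j).comp (h s hs)

lemma lintegral_noise_exp_le (B : LexBandit A D) (a : Fin A) (j : Fin D) (l : ℝ) :
    ∫⁻ x, ENNReal.ofReal (Real.exp (l * x j - l ^ 2 / 2)) ∂(B.noise a) ≤ 1 := by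
  have hs := B.noise_subgaussian a j
  simp_rw [Real.exp_sub]
  rw [← ofReal_integral_eq_lintegral_ofReal ((hs.integrable_exp_mul l).div_const _)
    (Filter.Eventually.of_forall fun x => by positivity), integral_div]
  rw [ENNReal.ofReal_le_one, div_le_one (Real.exp_pos _)]
  simpa [mgf] using hs.mgf_le l

instance (B : LexBandit A D) (H : Type*) [MeasurableSpace H] :
    IsMarkovKernel (B.noiseKernel H) := by
  refine ⟨fun x => ?_⟩
  exact B.noise_prob x.2

lemma noiseKernel_apply (B : LexBandit A D) (H : Type*) [MeasurableSpace H] (x : H × Fin A) :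
    B.noiseKernel H x = B.noise x.2 := by
  rfl

/-- The `σ`-algebra generated by the rounds before round `t` and the arm selected in round `t`. -/
abbrev selectionField (arm : ℕ → Ω → Fin A) (rwd : ℕ → Ω → Fin D → ℝ) (t : ℕ) : MeasurableSpace Ω :=
  MeasurableSpace.comap (fun ω => (history arm rwd t ω, arm t ω)) inferInstance

/-- The zero set of the conditional expectation is `m`-measurable, so `f` has integral zero over it.
-/
lemma ae_eq_zero_of_condExp_eq_zero {m mΩ : MeasurableSpace Ω} {P : Measure Ω}
    [IsFiniteMeasure P] (hm : m ≤ mΩ) {f : Ω → ℝ} (hfi : Integrable f P) (hf : 0 ≤ f) :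
    ∀ᵐ ω ∂P, (P[f | m]) ω = 0 → f ω = 0 := by
  have hZ : MeasurableSet[m] {ω | (P[f | m]) ω = 0} :=
    (stronglyMeasurable_condExp (f := f) (μ := P)).measurable (measurableSet_singleton 0)
  have hint : ∫ ω in {ω | (P[f | m]) ω = 0}, f ω ∂P = 0 := by
    rw [← setIntegral_condExp hm hfi hZ]
    exact setIntegral_eq_zero_of_forall_eq_zero fun ω hω => hω
  rwa [setIntegral_eq_zero_iff_of_nonneg_ae (Filter.Eventually.of_forall hf)
    hfi.integrableOn, Filter.EventuallyEq, ae_restrict_iff' (hm _ hZ)] at hint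

variable [mΩ : MeasurableSpace Ω] {P : Measure Ω} [IsProbabilityMeasure P]

omit [IsProbabilityMeasure P] in
lemma IsRun.measurable_history (hrun : IsRun B P arm rwd) (t : ℕ) :
    Measurable (history arm rwd t) :=
  measurable_pi_lambda _ fun s => (hrun.measurable_arm s).prodMk (hrun.measurable_rwd s)

/-- Multiplying by the compensated exponential of the current noise, on an event determined by the
past and the current arm, does not increase integrals of functions of the past. -/
lemma IsRun.lintegral_mul_exp_le (hrun : IsRun B P arm rwd) (j : Fin D) (l : ℝ)
    (t : ℕ) {f : Ω → ℝ≥0∞} {S : Set Ω}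
    (hf : Measurable[selectionField arm rwd t] f)
    (hS : MeasurableSet[selectionField arm rwd t] S) :
    ∫⁻ ω, f ω * S.indicator (fun ω => ENNReal.ofReal
        (Real.exp (l * (rwd t ω j - B.mean (arm t ω) j) - l ^ 2 / 2))) ω ∂P
      ≤ ∫⁻ ω, f ω * S.indicator 1 ω ∂P := by
  set Y := fun ω => (history arm rwd t ω, arm t ω) with hY
  have hlaw := hrun.noise_law t
  have hYm : Measurable Y := (hrun.measurable_history t).prodMk (hrun.measurable_arm t)
  obtain ⟨g, hg, rfl⟩ := hf.exists_eq_measurable_comp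
  obtain ⟨S', hS', rfl⟩ := hS
  let F : ((Fin t → Fin A × (Fin D → ℝ)) × Fin A) × (Fin D → ℝ) → ℝ≥0∞ := fun z =>
    g z.1 * Set.indicator (Prod.fst ⁻¹' S')
      (fun z : _ × (Fin D → ℝ) => ENNReal.ofReal (Real.exp (l * z.2 j - l ^ 2 / 2))) z
  have hF : Measurable F := by
    refine (hg.comp measurable_fst).mul (Measurable.indicator ?_ (measurable_fst hS'))
    fun_prop
  have h1 : ∫⁻ ω, (g ∘ Y) ω * (Y ⁻¹' S').indicator (fun ω => ENNReal.ofReal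
        (Real.exp (l * (rwd t ω j - B.mean (arm t ω) j) - l ^ 2 / 2))) ω ∂P =
      ∫⁻ ω, F (Y ω, fun i => rwd t ω i - B.mean (arm t ω) i) ∂P := rfl
  have hlaw' : P.map (fun ω => (Y ω, fun i => rwd t ω i - B.mean (arm t ω) i)) =
      P.map Y ⊗ₘ B.noiseKernel (Fin t → Fin A × (Fin D → ℝ)) := hlaw.map_eq
  rw [h1, ← lintegral_map' hF.aemeasurable hlaw.aemeasurable, hlaw',
    Measure.lintegral_compProd hF, lintegral_map (by fun_prop) hYm]
  refine lintegral_mono fun ω => ?_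
  by_cases hω : ω ∈ Y ⁻¹' S'
  · have hω' : Y ω ∈ S' := hω
    have hm : Measurable fun x : Fin D → ℝ =>
      ENNReal.ofReal (Real.exp (l * x j - l ^ 2 / 2)) := by fun_prop
    rw [Set.indicator_of_mem hω]
    simp only [F, Set.indicator, Set.mem_preimage, hω', if_true, noiseKernel_apply]
    rw [lintegral_const_mul _ hm]
    exact mul_le_mul_right (lintegral_noise_exp_le B _ j l) _
  · have hω' : Y ω ∉ S' := hω
    simp [F, Set.indicator, hω']

/-- Supermartingale property: a new factor appears only on an event known before the current noise,
and sub-Gaussianity makes its conditional mean at most 1. -/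
lemma IsRun.lintegral_exp_compensatedSum_le (hrun : IsRun B P arm rwd) (a : Fin A) (j : Fin D)
    (n : ℕ) (l : ℝ) (t : ℕ) :
    ∫⁻ ω, ENNReal.ofReal (Real.exp
      (compensatedSum B (fun s => arm s ω) (fun s => rwd s ω) a j n l t)) ∂P ≤ 1 := by
  induction t with
  | zero => simp [compensatedSum]
  | succ t ih =>
    have hYm : Measurable[selectionField arm rwd t] fun ω => (history arm rwd t ω, arm t ω) :=
      comap_measurable _
    have hhist : ∀ s < t, Measurable[selectionField arm rwd t]
        fun ω => (arm s ω, rwd s ω) := fun s hs =>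
      (measurable_pi_apply (⟨s, hs⟩ : Fin t)).comp (measurable_fst.comp hYm)
    have harm : ∀ s < t, Measurable[selectionField arm rwd t] (arm s) := fun s hs =>
      measurable_fst.comp (hhist s hs)
    have hrwd : ∀ s < t, Measurable[selectionField arm rwd t] (rwd s) := fun s hs =>
      measurable_snd.comp (hhist s hs)
    let S : Set Ω := {ω | arm t ω = a ∧ count (fun s => arm s ω) a t < n}
    have hS : MeasurableSet[selectionField arm rwd t] S :=
      (measurable_snd.comp hYm (measurableSet_singleton a)).inter
        (measurableSet_lt (measurable_count harm a) measurable_const)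
    have hmle : selectionField arm rwd t ≤ mΩ :=
      ((hrun.measurable_history t).prodMk (hrun.measurable_arm t)).comap_le
    let f : Ω → ℝ≥0∞ := fun ω => ENNReal.ofReal (Real.exp
      (compensatedSum B (fun s => arm s ω) (fun s => rwd s ω) a j n l t))
    have hf : Measurable[selectionField arm rwd t] f := by
      exact ENNReal.measurable_ofReal.comp
        (Real.measurable_exp.comp (measurable_compensatedSum harm hrwd a j n l))
    have hf' : Measurable f := hf.mono hmle le_rfl
    have hS' : MeasurableSet S := hmle _ hS
    have hg : Measurable fun ω => f ω * Sᶜ.indicator 1 ω :=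
      hf'.mul (measurable_one.indicator hS'.compl)
    have hsplit : ∀ ω, ENNReal.ofReal (Real.exp
        (compensatedSum B (fun s => arm s ω) (fun s => rwd s ω) a j n l (t + 1))) =
        f ω * S.indicator (fun ω => ENNReal.ofReal
          (Real.exp (l * (rwd t ω j - B.mean (arm t ω) j) - l ^ 2 / 2))) ω +
        f ω * Sᶜ.indicator 1 ω := by
      intro ω
      rw [compensatedSum, Finset.sum_range_succ]
      by_cases hω : ω ∈ S
      · have hω' : arm t ω = a ∧ count (fun s => arm s ω) a t < n := hω
        rw [if_pos hω', Real.exp_add, ENNReal.ofReal_mul (Real.exp_pos _).le]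
        simp [hω, f, compensatedSum]
      · have hω' : ¬ (arm t ω = a ∧ count (fun s => arm s ω) a t < n) := hω
        rw [if_neg hω']
        simp [hω, f, compensatedSum]
    calc _ = ∫⁻ ω, f ω * S.indicator (fun ω => ENNReal.ofReal
          (Real.exp (l * (rwd t ω j - B.mean (arm t ω) j) - l ^ 2 / 2))) ω ∂P +
        ∫⁻ ω, f ω * Sᶜ.indicator 1 ω ∂P := by
          rw [← lintegral_add_right _ hg]
          exact lintegral_congr hsplit
      _ ≤ ∫⁻ ω, f ω * S.indicator 1 ω ∂P + ∫⁻ ω, f ω * Sᶜ.indicator 1 ω ∂P := by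
          gcongr ?_ + _
          exact hrun.lintegral_mul_exp_le j l t hf hS
      _ = ∫⁻ ω, f ω ∂P := by
          rw [← lintegral_add_right _ hg]
          refine lintegral_congr fun ω => ?_
          by_cases hω : ω ∈ S <;> simp [hω]
      _ ≤ 1 := ih

/-- Maximal-type deviation inequality: the probability that the noise of the first `n` selections
of an arm, weighted by `l`, ever reaches `n * l ^ 2` is at most `exp (-n * l ^ 2 / 2)`. -/
lemma IsRun.measureReal_deviation_le (hrun : IsRun B P arm rwd) (a : Fin A) (j : Fin D)
    (n : ℕ) (l : ℝ) (T : ℕ) :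
    P.real {ω | ∃ t < T, count (fun s => arm s ω) a t = n ∧
      n * l ^ 2 ≤ l * noiseSum B (fun s => arm s ω) (fun s => rwd s ω) a j t} ≤
      Real.exp (-(n * (l ^ 2 / 2))) := by
  refine ENNReal.toReal_le_of_le_ofReal (Real.exp_pos _).le ?_
  let f : Ω → ℝ≥0∞ := fun ω => ENNReal.ofReal (Real.exp
    (compensatedSum B (fun s => arm s ω) (fun s => rwd s ω) a j n l T))
  have hf : Measurable f :=
    ENNReal.measurable_ofReal.comp (Real.measurable_exp.comp
      (measurable_compensatedSum (fun s _ => hrun.measurable_arm s)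
        (fun s _ => hrun.measurable_rwd s) a j n l))
  -- When the weighted noise reaches `n * l ^ 2`, subtracting the compensator `n * l ^ 2 / 2` still
  -- leaves this level.
  have hmarkov := meas_ge_le_lintegral_div hf.aemeasurable (μ := P)
    (ε := ENNReal.ofReal (Real.exp (n * (l ^ 2 / 2))))
    (by simp [Real.exp_pos]) ENNReal.ofReal_ne_top
  refine (measure_mono ?_).trans (hmarkov.trans ?_)
  · rintro ω ⟨t, ht, hn, hl⟩
    have h := compensatedSum_eq B (fun s => arm s ω) (fun s => rwd s ω) a j l ht.le
    rw [hn] at h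
    refine ENNReal.ofReal_le_ofReal (Real.exp_le_exp.2 ?_)
    rw [h]
    linarith
  · rw [Real.exp_neg, ENNReal.ofReal_inv_of_pos (Real.exp_pos _), ENNReal.div_eq_inv_mul]
    exact mul_le_of_le_one_right' (hrun.lintegral_exp_compensatedSum_le a j n l T)

/-- Almost surely, every selected arm has a positive selection probability. -/
lemma IsRun.ae_selectProb_ne_zero (hrun : IsRun B P arm rwd) :
    ∀ᵐ ω ∂P, ∀ t, selectProb (fun s => arm s ω) (fun s => rwd s ω) t (arm t ω) ≠ 0 := by
  rw [ae_all_iff]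
  intro t
  have hall : ∀ a, ∀ᵐ ω ∂P, arm t ω = a →
      selectProb (fun s => arm s ω) (fun s => rwd s ω) t a ≠ 0 := by
    intro a
    have hfi : Integrable (Set.indicator {ω | arm t ω = a} (fun _ => (1 : ℝ))) P :=
      (integrable_const (1 : ℝ)).indicator (hrun.measurable_arm t (measurableSet_singleton a))
    filter_upwards [hrun.arm_law t a, ae_eq_zero_of_condExp_eq_zero
      (hrun.measurable_history t).comap_le hfi
      fun ω => Set.indicator_nonneg (fun _ _ => zero_le_one) ω] with ω h1 h2 ha h0
    have := h2 (h1.trans h0)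
    simp [ha] at this
  filter_upwards [ae_all_iff.2 hall] with ω hω
  exact hω _ rfl

end OMLEX

/-! ### Gaps of lexicographically suboptimal arms. -/

namespace LexBandit

variable {A D : ℕ} {B : LexBandit A D} {star a : Fin A} {i : Fin D}

/-- The arm `a` is beaten for the first time in objective `i`, by some `b`. Up to there `star`
agrees with `a`, since otherwise one would dominate the other; were `star` below `b` in objective
`i`, then `b` would dominate `star`. -/
lemma gap_pos (hstar : star ∈ B.optArms D) (ha : a ∈ B.subArms i) : 0 < B.gap star a i := by
  simp only [subArms, optArms, Finset.mem_sdiff, Finset.mem_filter, Finset.mem_univ, true_and,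
    not_forall, not_not] at ha hstar
  obtain ⟨ha1, b, j, hji, hjl, hj⟩ := ha
  have hji' : j = i := by
    by_contra hne
    have : j.val ≠ i.val := fun h => hne (Fin.ext h)
    exact ha1 b ⟨j, by omega, hjl, hj⟩
  subst hji'
  have hpre : ∀ n : ℕ, ∀ l : Fin D, l.val = n → l < j → B.mean star l = B.mean a l := by
    intro n
    induction n using Nat.strong_induction_on with
    | _ n ih =>
      intro l hl hlj
      have hprev : ∀ r : Fin D, r < l → B.mean star r = B.mean a r := fun r hr =>
        ih r.val (hl ▸ hr) r rfl (hr.trans hlj)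
      rcases lt_trichotomy (B.mean star l) (B.mean a l) with h | h | h
      · exact absurd ⟨l, l.isLt, fun r hr => (hprev r hr).symm, h⟩ (hstar a)
      · exact h
      · exact absurd ⟨l, hlj, hprev, h⟩ (ha1 star)
  have hstarj : ¬ B.mean star j < B.mean b j := fun h =>
    hstar b ⟨j, j.isLt, fun l hl => (hjl l hl).trans (hpre _ l rfl hl).symm, h⟩
  rw [gap]
  linarith [not_lt.1 hstarj]

lemma exists_abs_gap_eq (B : LexBandit A D) (star a : Fin A) (i : Fin D) :
    ∃ j, |B.gap star a j| = B.maxAbsGap star a :=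
  have : Nonempty (Fin D) := ⟨i⟩
  exists_eq_ciSup_of_finite

lemma abs_gap_le (B : LexBandit A D) (star a : Fin A) (i : Fin D) :
    |B.gap star a i| ≤ B.maxAbsGap star a :=
  le_ciSup (f := fun j => |B.gap star a j|) (Set.finite_range _).bddAbove i

end LexBandit

/-! ### Deterministic estimates behind the constants. -/

namespace OMLEX

variable {A D : ℕ}

lemma sum_Icc_two_inv_sq_le (T : ℕ) :
    ∑ n ∈ Finset.Icc 2 T, ((n : ℝ) ^ 2)⁻¹ ≤ Real.pi ^ 2 / 6 - 1 := by
  have h := sum_le_hasSum (insert 1 (Finset.Icc 2 T)) (fun n _ => by positivity) hasSum_zeta_two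
  rw [Finset.sum_insert (by simp)] at h
  simp only [one_div, Nat.cast_one, one_pow, inv_one] at h
  linarith

lemma le_of_mul_lt_log {x y : ℝ} (hx : 0 < x) (hy : 0 < y)
    (h : y * x ^ 2 < 16 * Real.log y) : y ≤ 36 / x ^ 2 * Real.log (17 / x) ∧ x < 17 := by
  have hz : 0 < y * x ^ 2 := by positivity
  have h1 : Real.log (y * x ^ 2) = Real.log y + 2 * Real.log x := by
    rw [Real.log_mul hy.ne' (by positivity), Real.log_pow]; norm_num
  have h2 : Real.log (17 / x) = Real.log 17 - Real.log x := Real.log_div (by norm_num) hx.ne'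
  -- With `z = y * x ^ 2`, the tangent to `log` at 144 turns `z < 16 * (log z - 2 * log x)` into a
  -- linear inequality with factor `32 / (1 - 16/144) = 36`; then `144 = 12² ≤ 17²` gives the 17.
  have h3 := Real.log_le_sub_one_of_pos (show 0 < y * x ^ 2 / 144 by positivity)
  rw [Real.log_div hz.ne' (by norm_num)] at h3
  have h4 : Real.log 144 ≤ 2 * Real.log 17 := by
    rw [show 2 * Real.log 17 = Real.log (17 ^ 2) by rw [Real.log_pow]; norm_num]
    exact Real.log_le_log (by norm_num) (by norm_num)
  have h5 : y * x ^ 2 ≤ 36 * Real.log (17 / x) := by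
    rw [h2]; linarith
  constructor
  · rw [div_mul_eq_mul_div, le_div_iff₀ (by positivity)]
    exact h5
  · by_contra hcon
    have : Real.log 17 ≤ Real.log x := Real.log_le_log (by norm_num) (not_lt.1 hcon)
    linarith

-- The slack `2 - π²/6` keeps the bound valid when no `n` qualifies and `x > 17` makes the logarithm
-- negative. Added to the tail `π²/6 - 1` of the series it gives exactly 1.
open Classical in
lemma card_filter_mul_lt_log_le {x : ℝ} (hx : 0 < x) (T : ℕ) :
    (((Finset.Icc 2 T).filter fun n : ℕ => n * x ^ 2 < 16 * Real.log n).card : ℝ) ≤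
      36 / x ^ 2 * Real.log (17 / x) + (2 - Real.pi ^ 2 / 6) := by
  have hpi : Real.pi ^ 2 ≤ 3.15 ^ 2 := by
    have := Real.pi_lt_d2
    have := Real.pi_pos
    gcongr
  set F := (Finset.Icc 2 T).filter fun n : ℕ => n * x ^ 2 < 16 * Real.log n with hF
  have hmem : ∀ n ∈ F, (n : ℝ) ≤ 36 / x ^ 2 * Real.log (17 / x) ∧ x < 17 := by
    intro n hn
    rw [hF, Finset.mem_filter, Finset.mem_Icc] at hn
    exact le_of_mul_lt_log hx (by exact_mod_cast (by omega : 0 < n)) hn.2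
  rcases F.eq_empty_or_nonempty with he | ⟨n, hn⟩
  · rw [he, Finset.card_empty, Nat.cast_zero]
    rcases le_or_gt x 17 with h | h
    · have : 0 ≤ Real.log (17 / x) := Real.log_nonneg (by rwa [le_div_iff₀ hx, one_mul])
      have : 0 ≤ 36 / x ^ 2 * Real.log (17 / x) := by positivity
      linarith
    · have h1 : Real.log (x / 17) ≤ x / 17 - 1 := Real.log_le_sub_one_of_pos (by positivity)
      have h2 : Real.log (17 / x) = - Real.log (x / 17) := by
        rw [← Real.log_inv, inv_div]
      have h3 : 36 / x ^ 2 * Real.log (x / 17) ≤ 36 / x ^ 2 * (x / 17) := by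
        gcongr; linarith
      have h4 : 36 / x ^ 2 * (x / 17) ≤ 0.2 := by
        rw [show 36 / x ^ 2 * (x / 17) = 36 / 17 / x by field_simp, div_le_iff₀ hx]
        linarith
      rw [h2]
      linarith
  · have hu : 0 ≤ 36 / x ^ 2 * Real.log (17 / x) := le_trans (by positivity) (hmem n hn).1
    have hsub : F ⊆ Finset.Icc 1 ⌊36 / x ^ 2 * Real.log (17 / x)⌋₊ := by
      intro k hk
      rw [Finset.mem_Icc]
      refine ⟨?_, Nat.le_floor (hmem k hk).1⟩
      have := (Finset.mem_Icc.1 (Finset.mem_filter.1 hk).1).1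
      omega
    have hc : (F.card : ℝ) ≤ ⌊36 / x ^ 2 * Real.log (17 / x)⌋₊ := by
      have := Finset.card_le_card hsub
      rw [Nat.card_Icc, Nat.add_sub_cancel] at this
      exact_mod_cast this
    linarith [Nat.floor_le hu]

/-! ### Expected number of selections. -/

variable {Ω : Type*} [mΩ : MeasurableSpace Ω] {B : LexBandit A D} {P : Measure Ω}
  [IsProbabilityMeasure P] {arm : ℕ → Ω → Fin A} {rwd : ℕ → Ω → Fin D → ℝ}

open Classical in
lemma integral_le_add_sum_measureReal {f : Ω → ℝ} (hf : Integrable f P) {ι : Type*}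
    (s : Finset ι) (c : ℝ) (U : ι → Set Ω)
    (h : ∀ᵐ ω ∂P, f ω ≤ c + ((s.filter fun n => ω ∈ U n).card : ℝ)) :
    ∫ ω, f ω ∂P ≤ c + ∑ n ∈ s, P.real (U n) := by
  -- Measurable hulls have the same measure, so measurability of the `U n` need not be proved.
  have hi : ∀ n ∈ s, Integrable ((toMeasurable P (U n)).indicator fun _ => (1 : ℝ)) P :=
    fun n _ => (integrable_const _).indicator (measurableSet_toMeasurable _ _)
  have hle : ∫ ω, f ω ∂P ≤
      ∫ ω, (c + ∑ n ∈ s, (toMeasurable P (U n)).indicator (fun _ => (1 : ℝ)) ω) ∂P := by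
    refine integral_mono_ae hf ((integrable_const c).add (integrable_finsetSum s hi)) ?_
    filter_upwards [h] with ω hω
    refine hω.trans ?_
    rw [Finset.card_filter, Nat.cast_sum]
    gcongr with n hn
    by_cases hmem : ω ∈ U n
    · simp [hmem, subset_toMeasurable P (U n) hmem]
    · simpa [hmem] using Set.indicator_nonneg (fun _ _ => zero_le_one) ω
  refine hle.trans_eq ?_
  rw [integral_add (integrable_const c) (integrable_finsetSum s hi), integral_finsetSum s hi]
  simp [integral_indicator_const, Measure.real, measure_toMeasurable]

lemma exp_neg_two_log {n : ℕ} (hn : n ≠ 0) :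
    Real.exp (-(2 * Real.log n)) = ((n : ℝ) ^ 2)⁻¹ := by
  have : (0 : ℝ) < n := by positivity
  rw [Real.exp_neg, two_mul, Real.exp_add, Real.exp_log this, sq]

/-- The radius of the confidence interval for an arm that has been selected `n` times. -/
def radius (n : ℕ) : ℝ := √(4 * Real.log n / n)

lemma radius_nonneg (n : ℕ) : 0 ≤ radius n := Real.sqrt_nonneg _

lemma sq_radius (n : ℕ) : radius n ^ 2 = 4 * Real.log n / n :=
  Real.sq_sqrt (div_nonneg (mul_nonneg (by norm_num) (Real.log_natCast_nonneg n)) n.cast_nonneg)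

lemma mem_estOpt {arm : ℕ → Fin A} {rwd : ℕ → Fin D → ℝ} {t : ℕ} {a : Fin A} :
    a ∈ estOpt arm rwd t ↔ ∀ i, |sampleMean arm rwd a i t| < radius (count arm a t) := by
  simp [estOpt, radius]

/-- A one-sided violation of the confidence interval, after `n` selections of the arm, has
probability at most `n⁻²`. -/
lemma IsRun.measureReal_radius_le (hrun : IsRun B P arm rwd) (a : Fin A) (j : Fin D)
    {n : ℕ} (hn : n ≠ 0) (T : ℕ) {c : ℝ} (hc : c ^ 2 = 1) :
    P.real {ω | ∃ t < T, count (fun s => arm s ω) a t = n ∧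
      radius n ≤ c * (sampleMean (fun s => arm s ω) (fun s => rwd s ω) a j t - B.mean a j)} ≤
      ((n : ℝ) ^ 2)⁻¹ := by
  have hn' : (n : ℝ) ≠ 0 := by exact_mod_cast hn
  have h := hrun.measureReal_deviation_le a j n (c * radius n) T
  -- The radius is tuned so that the exponent is `2 * log n`; the sign `c = ±1` selects the side.
  have he : n * ((c * radius n) ^ 2 / 2) = 2 * Real.log n := by
    rw [mul_pow, hc, one_mul, sq_radius]
    field_simp
    ring
  rw [he, exp_neg_two_log hn] at h
  refine (measureReal_mono ?_).trans h
  rintro ω ⟨t, ht, hcount, hr⟩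
  refine ⟨t, ht, hcount, ?_⟩
  rw [noiseSum_eq B _ _ a j (by rw [hcount]; exact hn), hcount]
  have h1 : n * (c * radius n) ^ 2 = n * radius n * radius n := by
    rw [mul_pow, hc]; ring
  have h2 := mul_le_mul_of_nonneg_left hr
    (mul_nonneg (Nat.cast_nonneg n) (radius_nonneg n) : (0 : ℝ) ≤ n * radius n)
  rw [h1]
  linarith

lemma IsRun.measureReal_estOpt_eq_empty_le (hrun : IsRun B P arm rwd) {star : Fin A}
    (hzero : ∀ i, B.mean star i = 0) {n : ℕ} (hn : n ≠ 0) (T : ℕ) :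
    P.real {ω | ∃ t < T, count (fun s => arm s ω) star t = n ∧
      estOpt (fun s => arm s ω) (fun s => rwd s ω) t = ∅} ≤ 2 * D * ((n : ℝ) ^ 2)⁻¹ := by
  let E : Fin D → ℝ → Set Ω := fun j c => {ω | ∃ t < T, count (fun s => arm s ω) star t = n ∧
      radius n ≤ c * (sampleMean (fun s => arm s ω) (fun s => rwd s ω) star j t - B.mean star j)}
  have hE : ∀ j c, c ^ 2 = 1 → P.real (E j c) ≤ ((n : ℝ) ^ 2)⁻¹ := fun j c hc =>
    hrun.measureReal_radius_le star j hn T hc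
  calc _ ≤ P.real (⋃ j, (E j 1 ∪ E j (-1))) := by
        refine measureReal_mono ?_
        rintro ω ⟨t, ht, hcount, he⟩
        have hs : star ∉ estOpt (fun s => arm s ω) (fun s => rwd s ω) t := by simp [he]
        rw [mem_estOpt] at hs
        push Not at hs
        obtain ⟨j, hj⟩ := hs
        rw [hcount] at hj
        refine Set.mem_iUnion.2 ⟨j, ?_⟩
        rcases le_abs.1 hj with h | h
        · exact Or.inl ⟨t, ht, hcount, by rw [hzero]; linarith⟩
        · exact Or.inr ⟨t, ht, hcount, by rw [hzero]; linarith⟩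
    _ ≤ ∑ j, P.real (E j 1 ∪ E j (-1)) := measureReal_iUnion_fintype_le _
    _ ≤ ∑ _j : Fin D, 2 * ((n : ℝ) ^ 2)⁻¹ := by
        refine Finset.sum_le_sum fun j _ => (measureReal_union_le _ _).trans ?_
        linarith [hE j 1 (by norm_num), hE j (-1) (by norm_num)]
    _ = _ := by simp; ring

/-- Once the confidence radius is at most half the gap, a suboptimal arm is an estimated optimal
arm with small probability. -/
lemma IsRun.measureReal_mem_estOpt_le (hrun : IsRun B P arm rwd) (a : Fin A) (j : Fin D)
    {n : ℕ} (hn : n ≠ 0) (T : ℕ) (hgap : 16 * Real.log n ≤ n * B.mean a j ^ 2) :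
    P.real {ω | ∃ t < T, count (fun s => arm s ω) a t = n ∧
      a ∈ estOpt (fun s => arm s ω) (fun s => rwd s ω) t} ≤ ((n : ℝ) ^ 2)⁻¹ := by
  have hn' : (0 : ℝ) < n := by positivity
  have hr : 2 * radius n ≤ |B.mean a j| := by
    rw [← abs_of_nonneg (mul_nonneg zero_le_two (radius_nonneg n)), ← sq_le_sq, mul_pow, sq_radius,
      ← mul_div_assoc, div_le_iff₀ hn']
    linarith
  rcases le_total 0 (B.mean a j) with hm | hm
  · refine (measureReal_mono ?_).trans
      (hrun.measureReal_radius_le a j hn T (c := -1) (by norm_num))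
    rintro ω ⟨t, ht, hcount, he⟩
    have h := abs_lt.1 (mem_estOpt.1 he j)
    rw [hcount] at h
    rw [abs_of_nonneg hm] at hr
    exact ⟨t, ht, hcount, by linarith⟩
  · refine (measureReal_mono ?_).trans
      (hrun.measureReal_radius_le a j hn T (c := 1) (by norm_num))
    rintro ω ⟨t, ht, hcount, he⟩
    have h := abs_lt.1 (mem_estOpt.1 he j)
    rw [hcount] at h
    rw [abs_of_nonpos hm] at hr
    exact ⟨t, ht, hcount, by linarith⟩

lemma IsRun.integrable_count (hrun : IsRun B P arm rwd) (a : Fin A) (T : ℕ) :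
    Integrable (fun ω => (count (fun s => arm s ω) a T : ℝ)) P := by
  have hm : Measurable fun ω => (count (fun s => arm s ω) a T : ℝ) :=
    (measurable_of_countable (fun n : ℕ => (n : ℝ))).comp
      (measurable_count (fun s _ => hrun.measurable_arm s) a)
  refine Integrable.of_bound hm.aestronglyMeasurable T (Filter.Eventually.of_forall fun ω => ?_)
  simpa using count_le _ a T

/-- A bound for the expected number of selections of an arm with a mean of absolute value `x`. -/
lemma IsRun.integral_count_le (hrun : IsRun B P arm rwd) {star : Fin A}
    (hzero : ∀ i, B.mean star i = 0) (a : Fin A) (j : Fin D) {x : ℝ} (hx : 0 < x)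
    (hxj : |B.mean a j| = x) (T : ℕ) :
    ∫ ω, (count (fun s => arm s ω) a T : ℝ) ∂P ≤
      Real.pi ^ 2 / 3 * D + 1 + 36 / x ^ 2 * Real.log (17 / x) := by
  classical
  let U : ℕ → Set Ω := fun n => {ω | ∃ t < T, count (fun s => arm s ω) star t = n ∧
      estOpt (fun s => arm s ω) (fun s => rwd s ω) t = ∅}
  let V : ℕ → Set Ω := fun n => {ω | ∃ t < T, count (fun s => arm s ω) a t = n ∧
      a ∈ estOpt (fun s => arm s ω) (fun s => rwd s ω) t}
  have hD : (1 : ℝ) ≤ D := by exact_mod_cast j.pos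
  rcases Nat.eq_zero_or_pos T with rfl | hT
  -- Even for `T = 0` there is something to show, as the logarithm may be negative.
  · have := card_filter_mul_lt_log_le hx 0
    simp only [count, Finset.range_zero, Finset.filter_empty, Finset.card_empty, Nat.cast_zero,
      integral_zero] at *
    simp at this
    have : 0 ≤ Real.pi ^ 2 / 3 * (D - 1) := mul_nonneg (by positivity) (by linarith)
    nlinarith [Real.pi_gt_three]
  have hcount : ∀ᵐ ω ∂P, (count (fun s => arm s ω) a T : ℝ) ≤
      1 + (((Finset.Icc 1 T).disjSum (Finset.Icc 1 T)).filter
        fun n => ω ∈ Sum.elim U V n).card := by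
    filter_upwards [hrun.ae_selectProb_ne_zero] with ω hω
    have h := count_le_add hω a star T
    rw [Finset.card_filter, Finset.sum_disjSum, ← Finset.card_filter,
      ← Finset.card_filter]
    rw [add_assoc] at h
    norm_cast
    convert h <;> rfl
  have hint := integral_le_add_sum_measureReal (hrun.integrable_count a T) _ 1 _ hcount
  rw [Finset.sum_disjSum] at hint
  simp only [Sum.elim_inl, Sum.elim_inr] at hint
  have hIcc : Finset.Icc 1 T = insert 1 (Finset.Icc 2 T) := by
    ext n; simp only [Finset.mem_Icc, Finset.mem_insert]; omega
  rw [hIcc, Finset.sum_insert (by simp), Finset.sum_insert (by simp)] at hint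
  have hsum := sum_Icc_two_inv_sq_le T
  have hU1 : P.real (U 1) ≤ 1 := measureReal_le_one
  -- After one selection the radius is 0 and the acceptance test is strict, so no arm passes.
  have hV1 : P.real (V 1) = 0 := by
    have : V 1 = ∅ := by
      refine Set.eq_empty_of_forall_notMem ?_
      rintro ω ⟨t, -, hc, he⟩
      have h := mem_estOpt.1 he j
      rw [hc] at h
      have h0 : radius 1 = 0 := by simp [radius]
      exact absurd h (by rw [h0]; exact not_lt.2 (abs_nonneg _))
    rw [this, measureReal_empty]
  have hU : ∑ n ∈ Finset.Icc 2 T, P.real (U n) ≤ 2 * D * (Real.pi ^ 2 / 6 - 1) := by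
    calc _ ≤ ∑ n ∈ Finset.Icc 2 T, 2 * D * ((n : ℝ) ^ 2)⁻¹ :=
          Finset.sum_le_sum fun n hn => hrun.measureReal_estOpt_eq_empty_le hzero
            (by have := (Finset.mem_Icc.1 hn).1; omega) T
      _ ≤ _ := by rw [← Finset.mul_sum]; gcongr
  have hV : ∑ n ∈ Finset.Icc 2 T, P.real (V n) ≤
      36 / x ^ 2 * Real.log (17 / x) + (2 - Real.pi ^ 2 / 6) + (Real.pi ^ 2 / 6 - 1) := by
    calc _ ≤ ∑ n ∈ Finset.Icc 2 T,
          ((if n * x ^ 2 < 16 * Real.log n then 1 else 0) + ((n : ℝ) ^ 2)⁻¹) := by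
          refine Finset.sum_le_sum fun n hn => ?_
          split_ifs with h
          · have : P.real (V n) ≤ 1 := measureReal_le_one
            have : (0 : ℝ) ≤ ((n : ℝ) ^ 2)⁻¹ := by positivity
            linarith
          · rw [zero_add]
            refine hrun.measureReal_mem_estOpt_le a j
              (by have := (Finset.mem_Icc.1 hn).1; omega) T ?_
            rw [← sq_abs, hxj]
            exact not_lt.1 h
      _ ≤ _ := by
          rw [Finset.sum_add_distrib, Finset.sum_boole]
          exact add_le_add (card_filter_mul_lt_log_le hx T) hsum
  -- Besides the logarithm: 1 for the initial selection, 1 for `U 1`, `π²D/3 - 2D` for the other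
  -- blocks and 1 for acceptances. Then `3 - 2D ≤ 1` because `D ≥ 1`.
  linarith

lemma IsRun.integral_regretPB (hrun : IsRun B P arm rwd) (star : Fin A) (i : Fin D) (T : ℕ) :
    ∫ ω, B.regretPB star i (fun t => arm t ω) T ∂P =
      ∑ a ∈ B.subArms i, B.gap star a i * ∫ ω, (count (fun s => arm s ω) a T : ℝ) ∂P := by
  have h : ∀ ω, B.regretPB star i (fun t => arm t ω) T =
      ∑ a ∈ B.subArms i, B.gap star a i * (count (fun s => arm s ω) a T : ℝ) := by
    intro ω
    simp_rw [LexBandit.regretPB, count, Finset.card_filter, Nat.cast_sum, Finset.mul_sum]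
    rw [Finset.sum_comm]
    refine Finset.sum_congr rfl fun t _ => ?_
    simp
  simp_rw [h]
  rw [integral_finsetSum _ fun a _ => (hrun.integrable_count a T).const_mul _]
  simp_rw [integral_const_mul]

end OMLEX
end

theorem theorem1 {A D : ℕ} (B : LexBandit A D)
    (star : Fin A) (hstar : star ∈ B.optArms D)
    (hzero : ∀ i, B.mean star i = 0)
    {Ω : Type*} [MeasurableSpace Ω] (P : Measure Ω) [IsProbabilityMeasure P]
    (arm : ℕ → Ω → Fin A) (rwd : ℕ → Ω → Fin D → ℝ)
    (hrun : OMLEX.IsRun B P arm rwd) (i : Fin D) (T : ℕ) :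
    (∫ ω, B.regretPB star i (fun t => arm t ω) T ∂P ≤
      ∑ a ∈ B.subArms i,
        ((Real.pi ^ 2 / 3 * D + 1) * B.gap star a i +
          36 / B.maxAbsGap star a * max (Real.log (17 / B.maxAbsGap star a)) 0)) ∧
    ((∀ a ∈ B.subArms i,
        B.maxAbsGap star a ≤ 17 ∨ B.maxAbsGap star a = B.gap star a i) →
      ∫ ω, B.regretPB star i (fun t => arm t ω) T ∂P ≤
        ∑ a ∈ B.subArms i,
          ((Real.pi ^ 2 / 3 * D + 1) * B.gap star a i +
            36 / B.maxAbsGap star a * Real.log (17 / B.maxAbsGap star a))) := by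
  rw [hrun.integral_regretPB star i T]
  -- Here `y` stands for the logarithm or its positive part, which treats both bounds together.
  have hmain : ∀ a ∈ B.subArms i, 0 < B.gap star a i ∧ 0 < B.maxAbsGap star a ∧
      B.gap star a i ≤ B.maxAbsGap star a ∧
      ∀ y, Real.log (17 / B.maxAbsGap star a) ≤ y →
        (0 ≤ y ∨ B.maxAbsGap star a = B.gap star a i) →
        B.gap star a i * ∫ ω, (OMLEX.count (fun s => arm s ω) a T : ℝ) ∂P ≤
          (Real.pi ^ 2 / 3 * D + 1) * B.gap star a i + 36 / B.maxAbsGap star a * y := by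
    intro a ha
    have hg := B.gap_pos hstar ha
    have hle := (le_abs_self _).trans (B.abs_gap_le star a i)
    have hx := hg.trans_le hle
    obtain ⟨j, hj⟩ := B.exists_abs_gap_eq star a i
    have hj' : |B.mean a j| = B.maxAbsGap star a := by
      rw [← hj, LexBandit.gap, hzero, zero_sub, abs_neg]
    refine ⟨hg, hx, hle, fun y hy hcase => ?_⟩
    have hcount := hrun.integral_count_le hzero a j hx hj' T
    set x := B.maxAbsGap star a
    set g := B.gap star a i
    have h1 : 36 / x ^ 2 * Real.log (17 / x) ≤ 36 / x ^ 2 * y := by gcongr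
    have h2 : g * (36 / x ^ 2 * y) ≤ 36 / x * y := by
      have hxy : 36 / x * y = x * (36 / x ^ 2 * y) := by field_simp
      rw [hxy]
      rcases hcase with h0 | h0
      · gcongr
      · rw [h0]
    have h3 := mul_le_mul_of_nonneg_left (hcount.trans (add_le_add_right h1 _)) hg.le
    linarith
  constructor
  · exact Finset.sum_le_sum fun a ha =>
      (hmain a ha).2.2.2 _ (le_max_left _ _) (Or.inl (le_max_right _ _))
  · intro hcase
    refine Finset.sum_le_sum fun a ha => ?_
    obtain ⟨hg, hx, -, h⟩ := hmain a ha
    refine h _ le_rfl ((hcase a ha).imp_left fun h17 => Real.log_nonneg ?_)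
    rwa [le_div_iff₀ hx, one_mul]
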